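/- Let $U=\,]0,\infty[$, let $\mathcal D=C_c^\infty(U)$ be the space of test functions and $\mathcal D'$ the space of distributions on $U$ with the Borel $\sigma$-field of its weak-$\star$ topology. A random distribution is a measurable map from a probability space to $\mathcal D'$; an $n$-dimensional one has $n$ coordinates, each of which is a random distribution. Let $\xi=(\xi_1,\dots,\xi_m)$ be an $m$-dimensional white noise on a probability space: $\xi_1,\dots,\xi_m$ are independent random distributions such that every $\langle\xi_i,\phi\rangle$ is centred Gaussian and $E[\langle\xi_i,\phi\rangle\langle\xi_i,\psi\rangle]=\int_U\phi\psi$. Let $A,B\in\mathbb R^{n\times n}$, let $f\in(\mathcal D')^n$, and let $\Lambda\in\mathbb R^{n\times m}$. Consider the stochastic differential-algebraic equation $$A\dot x+Bx=f+\Lambda\xi ,$$ a solution of which is an $n$-dimensional random distribution $x$ such that, for almost every $\omega$, $A\langle\dot x(\omega),\phi\rangle+B\langle x(\omega),\phi\rangle=\langle f,\phi\rangle+\Lambda\langle\xi(\omega),\phi\rangle$ for all $\phi\in\mathcal D$. Assume that the pencil $(A,B)$ is regular, i.e. $\det(\lambda A+B)\ne0$ for some $\lambda\in\mathbb R$, and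 that $\Lambda$ has full row rank $n$. Let $P,Q$ be nonsingular $n\times n$ matrices that reduce the pencil to canonical form, $$PAQ=\begin{pmatrix}I_d&0\\0&N\end{pmatrix},\qquad PBQ=\begin{pmatrix}J&0\\0&I_q\end{pmatrix},\qquad d+q=n,\quad N \text{ nilpotent},$$ and let $r$ be the nilpotency index, i.e. the least $r\ge 0$ with $N^r=0$. Let $\phi_0\in\mathcal D$ be a test function, not identically zero, and let $u^0\in\mathbb R^d$. Let $x$ be a solution of the equation with the initial condition $$\langle Q^{-1}x,\phi_0\rangle_i=u^0_i\quad\text{almost surely},\qquad i=1,\dots,d .$$ Then $x$ is almost surely the only solution with this initial condition. Moreover, for every $k$ let $\mathcal E(k)$ be the set of test functions $\phi$ for which the covariance matrix of the $mk$-dimensional random vector $(\langle\xi,\phi\rangle,\dots,\langle\xi^{(k-1)},\phi\rangle)$ is nonsingular. Then for every $\phi\in\mathcal E(r)$ that, in case $d\ge1$, is not a scalar multiple of $\phi_0$, the law of the random vector $\langle x,\phi\rangle$ is absolutely continuous with respect to Lebesgue measure on $\mathbb R^n$. -/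

import Mathlib

open MeasureTheory ProbabilityTheory TopologicalSpace
open scoped Distributions LineDeriv Matrix

namespace SDAE

/-! ### Distributions on the open half-line -/

/-- The base set `U = ]0, +∞[` of all test functions and distributions. -/
def U : Opens ℝ := ⟨Set.Ioi 0, isOpen_Ioi⟩

/-- The space `𝓓 = C_c^∞(U)` of test functions, with its usual LF topology. -/
abbrev Test : Type := 𝓓(U, ℝ)

/-- The space `𝓓'` of distributions on `U`, i.e. of continuous linear forms on `𝓓`. -/
abbrev Distr : Type := 𝓓'(U, ℝ)

/-- The action `⟨T, φ⟩ = (⟨T₁, φ⟩, …, ⟨Tₙ, φ⟩)` of an `n`-dimensional distribution. -/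
noncomputable def pair {n : ℕ} (T : Fin n → Distr) (φ : Test) : Fin n → ℝ := fun i => T i φ

/-- The derivative of a distribution, `⟨T', φ⟩ = -⟨T, φ'⟩`. -/
noncomputable def deriv (T : Distr) : Distr := ∂_{(1 : ℝ)} T

theorem deriv_apply (T : Distr) (φ : Test) : deriv T φ = -T (∂_{(1 : ℝ)} φ) := by
  simp [deriv]

/-- The weak-⋆ topology on `𝓓'`: pointwise convergence on test functions. -/
@[reducible]
noncomputable def weakStar : TopologicalSpace Distr :=
  TopologicalSpace.induced (fun (T : Distr) (φ : Test) => T φ) inferInstance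

/-- The Borel `σ`-field `𝓑(𝓓')` of the weak-⋆ topology. -/
@[reducible]
noncomputable def borelDistr : MeasurableSpace Distr := @borel Distr weakStar

/-! ### Regular pencils and their canonical form -/

/-- The pencil `(A, B)` is regular: `det (λ A + B) ≠ 0` for some real `λ`. -/
def IsRegularPencil {n : ℕ} (A B : Matrix (Fin n) (Fin n) ℝ) : Prop :=
  ∃ l : ℝ, (l • A + B).det ≠ 0

/-- A reduction of the pencil `(A, B)` to canonical form: nonsingular `P`, `Q` with
`P A Q = diag (I_d, N)` and `P B Q = diag (J, I_q)`, where `d + q = n` and `N` is nilpotent.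
Neither `J` nor `N` is required to be in Jordan form, so every Kronecker canonical form (where in
addition `N` consists of nilpotent Jordan blocks) is an instance. -/
structure KroneckerForm {n : ℕ} (A B : Matrix (Fin n) (Fin n) ℝ) where
  /-- number of differential variables -/
  d : ℕ
  /-- number of algebraic variables -/
  q : ℕ
  hdq : d + q = n
  P : Matrix (Fin n) (Fin n) ℝ
  Q : Matrix (Fin n) (Fin n) ℝ
  hP : IsUnit P
  hQ : IsUnit Q
  J : Matrix (Fin d) (Fin d) ℝ
  N : Matrix (Fin q) (Fin q) ℝ
  hN : IsNilpotent N
  hA : P * A * Q = Matrix.reindex (finSumFinEquiv.trans (finCongr hdq))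
    (finSumFinEquiv.trans (finCongr hdq)) (Matrix.fromBlocks 1 0 0 N)
  hB : P * B * Q = Matrix.reindex (finSumFinEquiv.trans (finCongr hdq))
    (finSumFinEquiv.trans (finCongr hdq)) (Matrix.fromBlocks J 0 0 1)

/-- The nilpotency index: the least `r` with `N ^ r = 0`. If `N` consists of nilpotent
Jordan blocks, this is the dimension of the largest block (and `0` if there is no block). -/
noncomputable def KroneckerForm.index {n : ℕ} {A B : Matrix (Fin n) (Fin n) ℝ}
    (K : KroneckerForm A B) : ℕ :=
  nilpotencyClass K.N

/-! ### Existence of the canonical form of a regular pencil -/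

/-- Fitting decomposition of a square matrix, up to similarity. -/
theorem exists_fitting {n : ℕ} (M : Matrix (Fin n) (Fin n) ℝ) :
    ∃ (d q : ℕ) (h : d + q = n) (Q : Matrix (Fin n) (Fin n) ℝ)
      (M₁ : Matrix (Fin d) (Fin d) ℝ) (M₂ : Matrix (Fin q) (Fin q) ℝ),
      IsUnit Q ∧ IsUnit M₁ ∧ IsNilpotent M₂ ∧
      M * Q = Q * Matrix.reindexAlgEquiv ℝ ℝ (finSumFinEquiv.trans (finCongr h))
        (Matrix.fromBlocks M₁ 0 0 M₂) := by
  set g : Module.End ℝ (Fin n → ℝ) := Matrix.toLin' M with hg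
  obtain ⟨k, hk⟩ := Filter.eventually_atTop.mp g.eventually_isCompl_ker_pow_range_pow
  have hc : IsCompl (LinearMap.range (g ^ (k + 1))) (LinearMap.ker (g ^ (k + 1))) :=
    (hk (k + 1) (by omega)).symm
  set W := LinearMap.range (g ^ (k + 1)) with hW
  set V := LinearMap.ker (g ^ (k + 1)) with hV
  have hcomm : ∀ v, (g ^ (k + 1)) (g v) = g ((g ^ (k + 1)) v) := fun v => by
    rw [← Module.End.mul_apply, ← Module.End.mul_apply, ← pow_succ, ← pow_succ']
  have hgW : ∀ w ∈ W, g w ∈ W := by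
    rintro _ ⟨v, rfl⟩
    exact ⟨g v, hcomm v⟩
  have hgV : ∀ v ∈ V, g v ∈ V := fun v hv => by
    rw [hV, LinearMap.mem_ker] at hv ⊢
    rw [hcomm, hv, map_zero]
  let bW := Module.finBasis ℝ W
  let bV := Module.finBasis ℝ V
  let b := (bW.prod bV).map (Submodule.prodEquivOfIsCompl W V hc)
  have hdim : Module.finrank ℝ W + Module.finrank ℝ V = n := by
    rw [Submodule.finrank_add_eq_of_isCompl hc]; simp
  let e := finSumFinEquiv.trans (finCongr hdim)
  let b' := b.reindex e
  let M₁ := LinearMap.toMatrix bW bW (g.restrict hgW)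
  let M₂ := LinearMap.toMatrix bV bV (g.restrict hgV)
  have key : LinearMap.toMatrix b b g = Matrix.fromBlocks M₁ 0 0 M₂ := by
    have h1 : g ∘ₗ (Submodule.prodEquivOfIsCompl W V hc : (W × V) →ₗ[ℝ] (Fin n → ℝ)) =
        (Submodule.prodEquivOfIsCompl W V hc : (W × V) →ₗ[ℝ] (Fin n → ℝ)) ∘ₗ
          (g.restrict hgW).prodMap (g.restrict hgV) := by
      ext v <;> simp
    rw [← LinearMap.toMatrix_prodMap]
    ext i j
    have h2 := congrArg (fun l => l ((bW.prod bV) j)) h1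
    simp only [LinearMap.comp_apply, LinearEquiv.coe_coe] at h2
    rw [LinearMap.toMatrix_apply, LinearMap.toMatrix_apply]
    simp only [b, Module.Basis.map_apply, Module.Basis.map_repr, LinearEquiv.trans_apply]
    rw [h2, LinearEquiv.symm_apply_apply]
  refine ⟨_, _, hdim, (Pi.basisFun ℝ (Fin n)).toMatrix b', M₁, M₂, ?_, ?_, ?_, ?_⟩
  · have := (Pi.basisFun ℝ (Fin n)).invertibleToMatrix b'
    exact isUnit_of_invertible _
  · have hinj : Function.Injective (g.restrict hgW) := by
      rw [← LinearMap.ker_eq_bot, LinearMap.ker_eq_bot']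
      intro w hw
      have hw' : g w = 0 := congrArg Subtype.val hw
      have hwV : (w : Fin n → ℝ) ∈ V := by
        rw [hV, LinearMap.mem_ker, pow_succ, Module.End.mul_apply, hw', map_zero]
      have := (Submodule.disjoint_def.mp hc.disjoint) w w.2 hwV
      exact Subtype.ext this
    have hu : IsUnit (g.restrict hgW) := by
      rw [Module.End.isUnit_iff]
      exact ⟨hinj, LinearMap.injective_iff_surjective.mp hinj⟩
    exact hu.map (LinearMap.toMatrixAlgEquiv bW)
  · have hn : IsNilpotent (g.restrict hgV) := by
      refine ⟨k + 1, ?_⟩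
      rw [Module.End.pow_restrict]
      ext v : 1
      exact Subtype.ext v.2
    exact hn.map (LinearMap.toMatrixAlgEquiv bV)
  · have h3 : Matrix.reindexAlgEquiv ℝ ℝ (finSumFinEquiv.trans (finCongr hdim))
        (Matrix.fromBlocks M₁ 0 0 M₂) = LinearMap.toMatrix b' b' g := by
      rw [← key]
      ext i j
      simp only [Matrix.coe_reindexAlgEquiv, Matrix.reindex_apply, Matrix.submatrix_apply,
        LinearMap.toMatrix_apply, b', Module.Basis.reindex_apply, Module.Basis.repr_reindex_apply]
      rfl
    have h4 : M = LinearMap.toMatrix (Pi.basisFun ℝ (Fin n)) (Pi.basisFun ℝ (Fin n)) g := by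
      rw [LinearMap.toMatrix_eq_toMatrix', hg, LinearMap.toMatrix'_toLin']
    rw [h3, basis_toMatrix_mul_linearMap_toMatrix]
    conv_lhs => rw [h4]
    rw [linearMap_toMatrix_mul_basis_toMatrix]

/-- Every regular pencil has a canonical form. -/
theorem IsRegularPencil.nonempty_kroneckerForm {n : ℕ} {A B : Matrix (Fin n) (Fin n) ℝ}
    (h : IsRegularPencil A B) : Nonempty (KroneckerForm A B) := by
  obtain ⟨l, hl⟩ := h
  have hL : IsUnit (l • A + B).det := isUnit_iff_ne_zero.mpr hl
  set C := (l • A + B)⁻¹ with hC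
  have hCL : C * (l • A + B) = 1 := Matrix.nonsing_inv_mul _ hL
  have hCu : IsUnit C := by
    rw [hC, Matrix.isUnit_nonsing_inv_iff, Matrix.isUnit_iff_isUnit_det]; exact hL
  have hCB : C * B = 1 - l • (C * A) := by
    rw [← hCL, mul_add, Matrix.mul_smul]; abel
  obtain ⟨d, q, hdq, Q, M₁, M₂, hQ, hM₁, hM₂, hMQ⟩ := exists_fitting (C * A)
  set R := Matrix.reindexAlgEquiv ℝ ℝ (finSumFinEquiv.trans (finCongr hdq)) with hR
  have hS : IsUnit (1 - l • M₂) := IsNilpotent.isUnit_one_sub (hM₂.smul l)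
  have hM₁d := (Matrix.isUnit_iff_isUnit_det _).mp hM₁
  have hSd := (Matrix.isUnit_iff_isUnit_det _).mp hS
  have hQd := (Matrix.isUnit_iff_isUnit_det _).mp hQ
  set D := Matrix.fromBlocks M₁⁻¹ 0 0 (1 - l • M₂)⁻¹ with hD
  have hDu : IsUnit D := by
    refine IsUnit.of_mul_eq_one (Matrix.fromBlocks M₁ 0 0 (1 - l • M₂)) ?_
    rw [hD, Matrix.fromBlocks_multiply]
    simp [Matrix.nonsing_inv_mul _ hM₁d, Matrix.nonsing_inv_mul _ hSd, Matrix.fromBlocks_one]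
  have hA : R D * Q⁻¹ * C * A * Q = R (Matrix.fromBlocks 1 0 0 ((1 - l • M₂)⁻¹ * M₂)) := by
    calc R D * Q⁻¹ * C * A * Q = R D * (Q⁻¹ * (C * A * Q)) := by simp only [mul_assoc]
      _ = R D * R (Matrix.fromBlocks M₁ 0 0 M₂) := by
        rw [hMQ, ← mul_assoc Q⁻¹, Matrix.nonsing_inv_mul _ hQd, one_mul]
      _ = _ := by
        rw [← map_mul, hD, Matrix.fromBlocks_multiply]
        simp [Matrix.nonsing_inv_mul _ hM₁d]
  have hB : R D * Q⁻¹ * C * B * Q =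
      R (Matrix.fromBlocks (M₁⁻¹ * (1 - l • M₁)) 0 0 1) := by
    calc R D * Q⁻¹ * C * B * Q = R D * (Q⁻¹ * (C * B * Q)) := by simp only [mul_assoc]
      _ = R D * R (1 - l • Matrix.fromBlocks M₁ 0 0 M₂) := by
        rw [hCB, sub_mul, one_mul, Matrix.smul_mul, hMQ, mul_sub, Matrix.mul_smul,
          ← mul_assoc Q⁻¹, Matrix.nonsing_inv_mul _ hQd, one_mul, map_sub, map_one, map_smul]
      _ = _ := by
        have h1 : (1 : Matrix (Fin d ⊕ Fin q) (Fin d ⊕ Fin q) ℝ) -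
            l • Matrix.fromBlocks M₁ 0 0 M₂ =
            Matrix.fromBlocks (1 - l • M₁) 0 0 (1 - l • M₂) := by
          rw [← Matrix.fromBlocks_one, Matrix.fromBlocks_smul]
          ext (i | i) (j | j) <;> simp [Matrix.one_apply]
        rw [← map_mul, hD, h1, Matrix.fromBlocks_multiply]
        simp [Matrix.nonsing_inv_mul _ hSd]
  refine ⟨⟨d, q, hdq, R D * Q⁻¹ * C, Q, ?_, hQ, M₁⁻¹ * (1 - l • M₁),
    (1 - l • M₂)⁻¹ * M₂, ?_, hA, hB⟩⟩
  · exact ((hDu.map R).mul ((Matrix.isUnit_nonsing_inv_iff).mpr hQ)).mul hCu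
  · refine Commute.isNilpotent_mul_left ?_ hM₂
    have h1 : Commute M₂ (1 - l • M₂) :=
      (Commute.one_right M₂).sub_right ((Commute.refl M₂).smul_right l)
    obtain ⟨v, hv⟩ := hS
    rw [← hv, ← Matrix.coe_units_inv]
    rw [← hv] at h1
    exact h1.units_inv_right.symm

/-! ### Random distributions and white noise -/

section Random

variable {Ω : Type*} [MeasurableSpace Ω]

/-- `X` is an `n`-dimensional random distribution: each coordinate is a measurable map from `Ω`
to `(𝓓', 𝓑(𝓓'))`. -/
def IsRandomDistribution {n : ℕ} (X : Ω → Fin n → Distr) : Prop :=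
  ∀ i, Measurable[_, borelDistr] fun ω => X ω i

/-- One-dimensional white noise: a random distribution `ξ` such that every `⟨ξ, φ⟩` is centred
Gaussian, with correlation functional `E[⟨ξ, φ⟩ ⟨ξ, ψ⟩] = ∫_U φ ψ`. -/
structure IsWhiteNoise (ξ : Ω → Distr) (μ : Measure Ω) : Prop where
  measurable : Measurable[_, borelDistr] ξ
  gaussian : ∀ φ : Test, ∃ v, μ.map (fun ω => ξ ω φ) = gaussianReal 0 v
  correlation : ∀ φ ψ : Test,
    ∫ ω, ξ ω φ * ξ ω ψ ∂μ = ∫ s in (U : Set ℝ), φ s * ψ s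

/-- `m`-dimensional white noise: `m` independent one-dimensional white noises. -/
structure IsWhiteNoiseVec {m : ℕ} (ξ : Ω → Fin m → Distr) (μ : Measure Ω) : Prop where
  whiteNoise : ∀ i, IsWhiteNoise (fun ω => ξ ω i) μ
  indep : iIndepFun (β := fun _ : Fin m => Distr) (m := fun _ => borelDistr)
    (fun i ω => ξ ω i) μ

/-- The covariance matrix of the random vector `(⟨ξ, φ⟩, ⟨ξ', φ⟩, …, ⟨ξ^{(k-1)}, φ⟩)`, which has
`m k` real components. -/
noncomputable def covMatrix {m : ℕ} (ξ : Ω → Fin m → Distr) (μ : Measure Ω) (k : ℕ) (φ : Test) :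
    Matrix (Fin k × Fin m) (Fin k × Fin m) ℝ :=
  Matrix.of fun a b =>
    cov[fun ω => (deriv^[a.1] (ξ ω a.2)) φ, fun ω => (deriv^[b.1] (ξ ω b.2)) φ; μ]

/-- The set `𝓔(k)` of test functions at which this covariance matrix is nonsingular. -/
def nonsingularTests {m : ℕ} (ξ : Ω → Fin m → Distr) (μ : Measure Ω) (k : ℕ) : Set Test :=
  {φ | (covMatrix ξ μ k φ).det ≠ 0}

/-! ### Solutions -/

/-- The `n`-dimensional distribution `x` solves the linear DAE `A x' + B x = g`. -/
def IsDAESolution {n : ℕ} (A B : Matrix (Fin n) (Fin n) ℝ) (g x : Fin n → Distr) : Prop :=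
  ∀ φ : Test, A *ᵥ pair (fun i => deriv (x i)) φ + B *ᵥ pair x φ = pair g φ

/-- The random distribution `x` solves the SDAE `A x' + B x = f + Λ ξ`: for almost every `ω`, the
distribution `x ω` solves the DAE with right-hand side `f + Λ ξ(ω)`. -/
structure IsSDAESolution {n m : ℕ} (A B : Matrix (Fin n) (Fin n) ℝ) (f : Fin n → Distr)
    (Λ : Matrix (Fin n) (Fin m) ℝ) (ξ : Ω → Fin m → Distr) (μ : Measure Ω)
    (x : Ω → Fin n → Distr) : Prop where
  isRandomDistribution : IsRandomDistribution x
  ae_solution : ∀ᵐ ω ∂μ, IsDAESolution A B (fun i => f i + ∑ l, Λ i l • ξ ω l) (x ω)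

/-- The initial condition `⟨Q⁻¹ x, φ₀⟩ᵢ = u⁰ᵢ`, `i = 1, …, d`, almost surely: the differential
variables (the first `d` coordinates of `Q⁻¹ x`) take the value `u⁰` at `φ₀`. -/
def HasInitialValue {n : ℕ} {A B : Matrix (Fin n) (Fin n) ℝ} (K : KroneckerForm A B)
    (φ₀ : Test) (u₀ : Fin K.d → ℝ) (μ : Measure Ω) (x : Ω → Fin n → Distr) : Prop :=
  ∀ᵐ ω ∂μ, ∀ i : Fin K.d,
    (K.Q⁻¹ *ᵥ pair (x ω) φ₀) (Fin.cast K.hdq (Fin.castAdd K.q i)) = u₀ i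

end Random

end SDAE

/-! The proof is by duality. Integration by parts gives `⟨x, L η⟩ = ⟨f + Λξ, η⟩` with `L η = -Aᵀη' +
Bᵀη`, so everything depends on which vectors of test functions lie in the range of `L`. In canonical
coordinates `L` splits. The algebraic block `θ - Nᵀθ'` is onto because `N` is nilpotent. The
differential block `Jᵀθ - θ'` hits `ζ` as soon as `∫ Fζ = 0`, with `F` the inverse of a fundamental
matrix. These `d` conditions can be met by subtracting a vector `c φ₀`, provided that `M = ∫ F φ₀`
is nonsingular.

Nothing is assumed about `M`: its nonsingularity follows from the existence of `x`. Otherwise some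
`p φ₀` with `p ≠ 0` would be in the range of the differential block. Then `p ⬝ ⟨u, φ₀⟩`, with `u`
the differential variables, is constant by the initial condition, and also a constant plus `⟨ξ,
Λᵀη⟩`. Zero variance gives `Λᵀη = 0`, hence `η = 0` by full row rank, hence `p = 0`
(`IsSDAESolution.exists_adjoint_eq`).

So every `ζ` is `L η` plus a vector prescribed by the initial condition, and `⟨x, ζ⟩` is a constant
plus `⟨ξ, Λᵀη⟩`. This gives uniqueness, and makes `⟨x, φ⟩` Gaussian. If `a ⬝ ⟨x, φ⟩` has zero
variance, then again `η = 0`, so `a φ` is itself an initial-value vector. The conditions on `φ` then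
force `a = 0`, and a nondegenerate Gaussian law is absolutely continuous. -/

/-! ### Absolute continuity of nondegenerate Gaussian vectors -/

theorem MeasureTheory.Measure.AbsolutelyContinuous.pi_fin {n : ℕ} {μ ν : Fin n → Measure ℝ}
    [∀ i, SigmaFinite (μ i)] [∀ i, SigmaFinite (ν i)] (h : ∀ i, μ i ≪ ν i) :
    Measure.pi μ ≪ Measure.pi ν := by
  induction n with
  | zero => rw [Measure.pi_of_empty, Measure.pi_of_empty]
  | succ n ih =>
    have h1 := (measurePreserving_piFinSuccAbove μ 0).symm.map_eq
    have h2 := (measurePreserving_piFinSuccAbove ν 0).symm.map_eq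
    rw [← h1, ← h2]
    exact ((h 0).prod (ih fun i => h _)).map (MeasurableEquiv.measurable _)

theorem hasGaussianLaw_of_forall_dotProduct {Ω : Type*} [MeasurableSpace Ω] {μ : Measure Ω}
    {n : ℕ} {X : Ω → Fin n → ℝ} (hX : AEMeasurable X μ)
    (h : ∀ a : Fin n → ℝ, HasGaussianLaw (fun ω => a ⬝ᵥ X ω) μ) : HasGaussianLaw X μ := by
  refine ⟨isGaussian_of_isGaussian_map fun L => ?_⟩
  rw [AEMeasurable.map_map_of_aemeasurable (by fun_prop) hX]
  convert (h fun i => L (Pi.single i 1)).isGaussian_map using 2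
  ext ω
  conv_lhs => rw [Function.comp_apply, pi_eq_sum_univ' (X ω), map_sum]
  refine Finset.sum_congr rfl fun i _ => ?_
  rw [map_smul, smul_eq_mul, mul_comm]

/-- In a basis orthogonal for the covariance form the coordinates are uncorrelated and jointly
Gaussian, hence independent. The law is then a product of nondegenerate real Gaussians, carried back
by an invertible matrix. -/
theorem ProbabilityTheory.HasGaussianLaw.absolutelyContinuous_map {Ω : Type*} [MeasurableSpace Ω]
    {μ : Measure Ω} {n : ℕ} {X : Ω → Fin n → ℝ} (hX : HasGaussianLaw X μ)
    (h : ∀ a : Fin n → ℝ, a ≠ 0 → Var[fun ω => a ⬝ᵥ X ω; μ] ≠ 0) :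
    μ.map X ≪ volume := by
  have := hX.isProbabilityMeasure
  have hL (a : Fin n → ℝ) : HasGaussianLaw (fun ω => a ⬝ᵥ X ω) μ :=
    hX.map (LinearMap.toContinuousLinearMap (dotProductBilin ℝ ℝ a))
  have hm (a : Fin n → ℝ) := (hL a).memLp_two
  let C : LinearMap.BilinForm ℝ (Fin n → ℝ) := LinearMap.mk₂ ℝ
    (fun a b => cov[fun ω => a ⬝ᵥ X ω, fun ω => b ⬝ᵥ X ω; μ])
    (fun a a' b => by
      simp only [add_dotProduct]; exact covariance_add_left (hm a) (hm a') (hm b))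
    (fun c a b => by
      simp only [smul_dotProduct, smul_eq_mul]; exact covariance_const_mul_left c)
    (fun a b b' => by
      simp only [add_dotProduct]; exact covariance_add_right (hm a) (hm b) (hm b'))
    (fun c a b => by
      simp only [smul_dotProduct, smul_eq_mul]; exact covariance_const_mul_right c)
  have hC : LinearMap.IsSymm C := ⟨fun a b => covariance_comm _ _⟩
  obtain ⟨b₀, hb₀⟩ := LinearMap.BilinForm.exists_orthogonal_basis hC
  let e : Fin (Module.finrank ℝ (Fin n → ℝ)) ≃ Fin n := finCongr (by simp)
  let b := b₀.reindex e
  have hb (i j : Fin n) (hij : i ≠ j) :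
      cov[fun ω => b i ⬝ᵥ X ω, fun ω => b j ⬝ᵥ X ω; μ] = 0 := by
    have := hb₀ (i := e.symm i) (j := e.symm j) (by simpa using hij)
    simpa [b, C, LinearMap.IsOrthoᵢ] using this
  let L : Matrix (Fin n) (Fin n) ℝ := Matrix.of fun i => b i
  have hLu : IsUnit L := by
    rw [← Matrix.linearIndependent_rows_iff_isUnit]
    exact b.linearIndependent
  have hLd := (Matrix.isUnit_iff_isUnit_det _).mp hLu
  have hY : HasGaussianLaw (fun ω i => b i ⬝ᵥ X ω) μ :=
    hX.map (LinearMap.toContinuousLinearMap (Matrix.toLin' L))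
  have hind := hY.iIndepFun_of_covariance_eq_zero (X := fun i ω => b i ⬝ᵥ X ω) hb
  rw [iIndepFun_iff_map_fun_eq_pi_map fun i => (hL (b i)).aemeasurable] at hind
  have hac : μ.map (fun ω i => b i ⬝ᵥ X ω) ≪ volume := by
    rw [hind]
    have (i : Fin n) : SigmaFinite (μ.map fun ω => b i ⬝ᵥ X ω) := by
      have := (hL (b i)).isGaussian_map
      infer_instance
    refine Measure.AbsolutelyContinuous.pi_fin fun i => ?_
    rw [(hL (b i)).map_eq_gaussianReal]
    refine gaussianReal_absolutelyContinuous _ ?_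
    rw [Ne, Real.toNNReal_eq_zero, not_le]
    exact lt_of_le_of_ne (variance_nonneg _ _) (h _ (b.ne_zero i)).symm
  have hXY : X = Matrix.toLin' L⁻¹ ∘ fun ω i => b i ⬝ᵥ X ω := by
    ext ω : 1
    change X ω = L⁻¹ *ᵥ (L *ᵥ X ω)
    rw [Matrix.mulVec_mulVec, Matrix.nonsing_inv_mul _ hLd, Matrix.one_mulVec]
  have hq := MeasureTheory.Measure.LinearMap.quasiMeasurePreserving (μ := (volume : Measure (Fin n → ℝ)))
    (Matrix.toLin' L⁻¹) (by
      rw [LinearMap.det_toLin', Matrix.det_nonsing_inv]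
      simpa using hLd.ne_zero)
  rw [hXY, ← AEMeasurable.map_map_of_aemeasurable hq.measurable.aemeasurable hY.aemeasurable]
  exact (hac.map hq.measurable).trans hq.absolutelyContinuous

namespace SDAE

/-! ### Test functions -/

theorem lineDeriv_test_apply (φ : Test) (t : ℝ) : (∂_{(1 : ℝ)} φ : Test) t = _root_.deriv φ t := by
  rw [TestFunction.lineDerivOp_eq_lineDerivCLM ℝ, TestFunction.lineDerivCLM_apply_of_le (by simp)]
  simp [lineDeriv, _root_.deriv_comp_const_add]

theorem hasDerivAt_test (φ : Test) (t : ℝ) : HasDerivAt φ ((∂_{(1 : ℝ)} φ : Test) t) t := by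
  rw [lineDeriv_test_apply]
  exact ((φ.contDiff.differentiable (by simp)) t).hasDerivAt

theorem integrable_test_mul (f : ℝ → ℝ) (hf : Continuous f) (φ : Test) :
    Integrable fun t => f t * φ t :=
  (hf.mul φ.continuous).integrable_of_hasCompactSupport φ.hasCompactSupport.mul_left

/-- The product of a smooth function and a test function. -/
noncomputable def smoothMul (f : ℝ → ℝ) (hf : ContDiff ℝ (⊤ : ℕ∞) f) (φ : Test) : Test where
  toFun t := f t * φ t
  contDiff' := hf.mul φ.contDiff
  hasCompactSupport' := φ.hasCompactSupport.mul_left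
  tsupport_subset' := (tsupport_mul_subset_right (f := f) (g := φ)).trans φ.tsupport_subset

theorem smoothMul_apply (f : ℝ → ℝ) (hf : ContDiff ℝ (⊤ : ℕ∞) f) (φ : Test) (t : ℝ) :
    smoothMul f hf φ t = f t * φ t := rfl

/-- The primitive based at `0` vanishes to the left of the support, and to its right because the
total integral is zero. Its support stays away from `0` because that of `φ` has a positive lower
bound. -/
theorem exists_primitive_test (φ : Test) (h : ∫ t, φ t = 0) :
    ∃ ψ : Test, ∂_{(1 : ℝ)} ψ = φ := by
  have hint : Integrable φ := φ.continuous.integrable_of_hasCompactSupport φ.hasCompactSupport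
  obtain ⟨a, b, ha, hab⟩ : ∃ a b : ℝ, 0 < a ∧ tsupport φ ⊆ Set.Icc a b := by
    rcases (tsupport φ).eq_empty_or_nonempty with he | hne
    · exact ⟨1, 1, one_pos, by simp [he]⟩
    · have hc : IsCompact (tsupport φ) := φ.hasCompactSupport
      exact ⟨sInf (tsupport φ), sSup (tsupport φ), φ.tsupport_subset (hc.sInf_mem hne),
        fun t ht => ⟨csInf_le hc.bddBelow ht, le_csSup hc.bddAbove ht⟩⟩
  have hz (t : ℝ) (ht : t ∉ Set.Icc a b) : φ t = 0 :=
    image_eq_zero_of_notMem_tsupport fun h' => ht (hab h')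
  let F : ℝ → ℝ := fun t => ∫ s in (0 : ℝ)..t, φ s
  have hF (t : ℝ) : HasDerivAt F (φ t) t :=
    φ.continuous.integral_hasStrictDerivAt 0 t |>.hasDerivAt
  have hFd : _root_.deriv F = φ := funext fun t => (hF t).deriv
  have hFc : ContDiff ℝ (⊤ : ℕ∞) F := by
    rw [contDiff_infty_iff_deriv, hFd]
    exact ⟨fun t => (hF t).differentiableAt, φ.contDiff⟩
  have hlt (t : ℝ) (ht : t < a) : F t = 0 := by
    refine intervalIntegral.integral_zero_ae (.of_forall fun s hs => hz s fun h' => ?_)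
    rcases le_max_iff.mp hs.2 with h1 | h1
    · linarith [h'.1]
    · linarith [h'.1]
  have hgt (t : ℝ) (ht : b < t) : F t = 0 := by
    have h1 : ∫ s in Set.Iic t, φ s = 0 := by
      rw [← h]
      refine setIntegral_eq_integral_of_forall_compl_eq_zero fun s hs => hz s fun h' => ?_
      exact hs (h'.2.trans ht.le)
    have h2 : ∫ s in Set.Iic (0 : ℝ), φ s = 0 :=
      setIntegral_eq_zero_of_forall_eq_zero fun s hs => hz s fun h' =>
        absurd (lt_of_lt_of_le ha h'.1) (not_lt.mpr hs)
    have := intervalIntegral.integral_Iic_sub_Iic (μ := volume) (f := φ) (a := 0) (b := t)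
      hint.integrableOn hint.integrableOn
    change ∫ s in (0 : ℝ)..t, φ s = 0
    rw [← this, h1, h2, sub_zero]
  have hs : tsupport F ⊆ Set.Icc a b := by
    refine closure_minimal (fun t ht => ?_) isClosed_Icc
    by_contra h'
    rw [Set.mem_Icc, not_and_or, not_le, not_le] at h'
    exact ht (h'.elim (hlt t) (hgt t))
  refine ⟨⟨F, hFc, isCompact_Icc.of_isClosed_subset (isClosed_tsupport F) hs,
    hs.trans fun t ht => lt_of_lt_of_le ha ht.1⟩, ?_⟩
  ext t
  rw [lineDeriv_test_apply]
  exact (hF t).deriv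

/-! ### Matrices acting on vectors of test functions -/

section Act

variable {ι κ l : Type*}

/-- The action of a matrix on vectors of test functions. -/
noncomputable def act [Fintype ι] (M : Matrix κ ι ℝ) : (ι → Test) →ₗ[ℝ] (κ → Test) where
  toFun η i := ∑ j, M i j • η j
  map_add' η θ := by ext1 i; simp [smul_add, Finset.sum_add_distrib]
  map_smul' c η := by ext1 i; simp [Finset.smul_sum, smul_comm c]

theorem act_apply [Fintype ι] (M : Matrix κ ι ℝ) (η : ι → Test) (i : κ) : act M η i = ∑ j, M i j • η j := rfl

theorem test_sum_apply (s : Finset ι) (η : ι → Test) (t : ℝ) :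
    (∑ i ∈ s, η i) t = ∑ i ∈ s, η i t := by
  classical
  induction s using Finset.induction_on with
  | empty => simp
  | insert a s ha ih => rw [Finset.sum_insert ha, Finset.sum_insert ha, ← ih]; rfl

theorem act_apply_apply [Fintype ι] (M : Matrix κ ι ℝ) (η : ι → Test) (i : κ) (t : ℝ) :
    act M η i t = (M *ᵥ fun j => η j t) i := by
  rw [act_apply, test_sum_apply]
  rfl

theorem act_mul [Fintype ι] [Fintype κ] (M : Matrix l κ ℝ) (N : Matrix κ ι ℝ) (η : ι → Test) :
    act (M * N) η = act M (act N η) := by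
  ext i t
  simp only [act_apply_apply, ← Matrix.mulVec_mulVec]

theorem act_one [Fintype ι] [DecidableEq ι] (η : ι → Test) : act (1 : Matrix ι ι ℝ) η = η := by
  ext i t
  simp [act_apply_apply]

theorem act_zero [Fintype ι] (η : ι → Test) : act (0 : Matrix κ ι ℝ) η = 0 := by
  ext i t
  simp [act_apply_apply]

/-- The componentwise derivative of a vector of test functions. -/
noncomputable def vderiv : (ι → Test) →ₗ[ℝ] (ι → Test) where
  toFun η i := ∂_{(1 : ℝ)} (η i)
  map_add' η θ := by ext1 i; simp [LineDeriv.lineDerivOp_add]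
  map_smul' c η := by ext1 i; simp [LineDeriv.lineDerivOp_smul]

theorem vderiv_apply (η : ι → Test) (i : ι) : vderiv η i = ∂_{(1 : ℝ)} (η i) := rfl

theorem vderiv_act [Fintype ι] (M : Matrix κ ι ℝ) (η : ι → Test) : vderiv (act M η) = act M (vderiv η) := by
  ext1 i
  have := map_sum (TestFunction.lineDerivCLM ℝ (1 : ℝ) : Test →L[ℝ] Test)
    (fun j => M i j • η j) Finset.univ
  simp only [map_smul] at this
  exact this

theorem act_reindex [Fintype ι] [Fintype κ] (e : ι ≃ κ) (M : Matrix ι ι ℝ) (η : ι → Test) :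
    act (Matrix.reindex e e M) (η ∘ e.symm) = act M η ∘ e.symm := by
  ext1 i
  simp only [act_apply, Function.comp_apply, Matrix.reindex_apply, Matrix.submatrix_apply]
  exact e.symm.sum_comp fun j => M (e.symm i) j • η j

theorem act_fromBlocks_diagonal [Fintype ι] [Fintype κ] (M : Matrix ι ι ℝ) (N : Matrix κ κ ℝ) (η : ι → Test)
    (θ : κ → Test) :
    act (Matrix.fromBlocks M 0 0 N) (Sum.elim η θ) = Sum.elim (act M η) (act N θ) := by
  ext1 i
  rcases i with i | i <;> simp [act_apply, Fintype.sum_sum_type]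

theorem act_injective_of_left_inv [Fintype ι] [Fintype κ] [DecidableEq ι] {M : Matrix κ ι ℝ} {N : Matrix ι κ ℝ}
    (h : N * M = 1) : Function.Injective (act M) := by
  refine Function.LeftInverse.injective (g := act N) fun η => ?_
  rw [← act_mul, h, act_one]

end Act

/-! ### Solving the adjoint equation -/

/-- A constant matrix commutes with differentiation, so `θ ↦ N θ'` is nilpotent and `1` minus it is
invertible. -/
theorem exists_sub_act_vderiv_eq {q : ℕ} {N : Matrix (Fin q) (Fin q) ℝ} (hN : IsNilpotent N)
    (ζ : Fin q → Test) : ∃ θ, θ - act N (vderiv θ) = ζ := by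
  let T : Module.End ℝ (Fin q → Test) := act N * vderiv
  have hc : Commute (act N : Module.End ℝ (Fin q → Test)) vderiv :=
    LinearMap.ext fun η => (vderiv_act N η).symm
  have hpow (k : ℕ) : (act N : Module.End ℝ (Fin q → Test)) ^ k = act (N ^ k) := by
    induction k with
    | zero => exact LinearMap.ext fun η => by simp [act_one]
    | succ k ih => rw [pow_succ, pow_succ, ih]; exact LinearMap.ext fun η => (act_mul (N ^ k) N η).symm
  have hT : IsNilpotent T := by
    refine Commute.isNilpotent_mul_right hc ?_
    obtain ⟨k, hk⟩ := hN
    exact ⟨k, by rw [hpow, hk]; exact LinearMap.ext act_zero⟩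
  obtain ⟨θ, hθ⟩ := ((Module.End.isUnit_iff _).mp hT.isUnit_one_sub).2 ζ
  exact ⟨θ, hθ⟩

section

attribute [local instance] Matrix.linftyOpNormedRing Matrix.linftyOpNormedAlgebra

/-- The matrices are `exp (tJ)` and `exp (-tJ)`. Regularity is stated entrywise, so that the
statement does not refer to the matrix norm chosen locally for the proof. -/
theorem exists_fundamental_matrix {d : ℕ} (J : Matrix (Fin d) (Fin d) ℝ) :
    ∃ E F : ℝ → Matrix (Fin d) (Fin d) ℝ,
      (∀ i j, ContDiff ℝ (⊤ : ℕ∞) fun t => E t i j) ∧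
      (∀ i j, ContDiff ℝ (⊤ : ℕ∞) fun t => F t i j) ∧
      (∀ t, E t * F t = 1) ∧
      ∀ i j t, HasDerivAt (fun t => E t i j) ((J * E t) i j) t := by
  have hs (K : Matrix (Fin d) (Fin d) ℝ) (i j) :
      ContDiff ℝ (⊤ : ℕ∞) fun t : ℝ => NormedSpace.exp (t • K) i j := by
    have h1 : ContDiff ℝ (⊤ : ℕ∞) fun t : ℝ => NormedSpace.exp (t • K) := by
      have h2 : ContDiff ℝ (⊤ : ℕ∞)
          (NormedSpace.exp : Matrix (Fin d) (Fin d) ℝ → Matrix (Fin d) (Fin d) ℝ) :=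
        AnalyticOnNhd.contDiff fun x _ => NormedSpace.exp_analytic x
      exact h2.comp (contDiff_id.smul contDiff_const)
    exact (Matrix.entryLinearMap ℝ ℝ i j).toContinuousLinearMap.contDiff.comp h1
  refine ⟨fun t => NormedSpace.exp (t • J), fun t => NormedSpace.exp (t • (-J)), hs J, hs (-J),
    fun t => ?_, fun i j t => ?_⟩
  · beta_reduce
    rw [smul_neg, Matrix.exp_neg, Matrix.mul_nonsing_inv]
    exact (Matrix.isUnit_iff_isUnit_det _).mp (Matrix.isUnit_exp _)
  · exact (Matrix.entryLinearMap ℝ ℝ i j).toContinuousLinearMap.hasFDerivAt.comp_hasDerivAt t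
      (hasDerivAt_exp_smul_const' J t)

end

/-- If `-θ' + J θ = p φ₀` has no solution in test functions for any `p ≠ 0`, then
`-θ' + J θ = ζ` is solvable for every `ζ` modulo multiples of `φ₀`. -/
theorem exists_act_sub_vderiv_eq {d : ℕ} (J : Matrix (Fin d) (Fin d) ℝ) (φ₀ : Test)
    (h : ∀ (p : Fin d → ℝ) (θ : Fin d → Test),
      act J θ - vderiv θ = (fun i => p i • φ₀) → p = 0) (ζ : Fin d → Test) :
    ∃ (c : Fin d → ℝ) (θ : Fin d → Test), act J θ - vderiv θ = ζ - fun i => c i • φ₀ := by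
  obtain ⟨E, F, hE, hF, hEF, hEd⟩ := exists_fundamental_matrix J
  -- Variation of constants: `θ = -E ψ` with `ψ' = F ζ` satisfies `θ' = J θ - ζ`. Zero integral of
  -- `F ζ` is what makes `ψ` a test function.
  have solve (ζ : Fin d → Test) (hζ : ∀ i, ∑ j, ∫ t, F t i j * ζ j t = 0) :
      ∃ θ : Fin d → Test, act J θ - vderiv θ = ζ := by
    have hprim (i : Fin d) : ∃ ψ : Test, ∂_{(1 : ℝ)} ψ = ∑ j, smoothMul _ (hF i j) (ζ j) := by
      refine exists_primitive_test _ ?_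
      simp only [test_sum_apply, smoothMul_apply]
      rw [integral_finsetSum _ fun j _ => integrable_test_mul _ (hF i j).continuous _]
      exact hζ i
    choose ψ hψ using hprim
    refine ⟨fun i => -∑ j, smoothMul _ (hE i j) (ψ j), ?_⟩
    ext i t
    have hψd (j : Fin d) : HasDerivAt (ψ j) ((F t *ᵥ fun k => ζ k t) j) t := by
      have := hasDerivAt_test (ψ j) t
      rw [hψ, test_sum_apply] at this
      exact this
    have hθd : HasDerivAt (fun t => -∑ j, E t i j * ψ j t)
        (-∑ j, ((J * E t) i j * ψ j t + E t i j * (F t *ᵥ fun k => ζ k t) j)) t :=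
      (HasDerivAt.fun_sum fun j _ => (hEd i j t).mul (hψd j)).neg
    have h1 : (vderiv (fun i => -∑ j, smoothMul _ (hE i j) (ψ j)) i) t =
        -∑ j, ((J * E t) i j * ψ j t + E t i j * (F t *ᵥ fun k => ζ k t) j) := by
      rw [vderiv_apply, lineDeriv_test_apply, ← hθd.deriv]
      congr 1
      ext s
      rw [neg_apply, test_sum_apply]
      rfl
    have h2 : (act J (fun i => -∑ j, smoothMul _ (hE i j) (ψ j)) i) t =
        -∑ j, (J * E t) i j * ψ j t := by
      have : (fun k => (-∑ j, smoothMul _ (hE k j) (ψ j)) t) = -(E t *ᵥ fun j => ψ j t) := by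
        ext k
        rw [neg_apply, test_sum_apply]
        rfl
      rw [act_apply_apply, this, Matrix.mulVec_neg, Matrix.mulVec_mulVec]
      rfl
    have h3 : ∑ j, E t i j * (F t *ᵥ fun k => ζ k t) j = ζ i t := by
      change (E t *ᵥ (F t *ᵥ fun k => ζ k t)) i = _
      rw [Matrix.mulVec_mulVec, hEF, Matrix.one_mulVec]
    rw [Pi.sub_apply, sub_apply, h1, h2, Finset.sum_add_distrib, h3]
    ring
  -- `M p` is the obstruction to solving for `p φ₀`; a kernel vector of `M` would contradict `h`.
  let M : Matrix (Fin d) (Fin d) ℝ := Matrix.of fun i j => ∫ t, F t i j * φ₀ t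
  have hMp (p : Fin d → ℝ) (i : Fin d) :
      ∑ j, ∫ t, F t i j * (p j • φ₀) t = (M *ᵥ p) i := by
    refine Finset.sum_congr rfl fun j _ => ?_
    change _ = (∫ t, F t i j * φ₀ t) * p j
    rw [← integral_mul_const]
    refine integral_congr_ae (.of_forall fun t => ?_)
    simp only [smul_apply, smul_eq_mul]
    ring
  have hM : IsUnit M.det := by
    rw [isUnit_iff_ne_zero]
    intro h0
    obtain ⟨p, hp, hMp0⟩ := Matrix.exists_mulVec_eq_zero_iff.mpr h0
    obtain ⟨θ, hθ⟩ := solve (fun i => p i • φ₀) fun i => by rw [hMp, hMp0]; rfl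
    exact hp (h p θ hθ)
  let v : Fin d → ℝ := fun i => ∑ j, ∫ t, F t i j * ζ j t
  -- `v` is the obstruction for `ζ`, and `c = M⁻¹ v` cancels it.
  refine ⟨M⁻¹ *ᵥ v, solve _ fun i => ?_⟩
  have hsub (j : Fin d) : ∫ t, F t i j * (ζ - fun i => (M⁻¹ *ᵥ v) i • φ₀) j t =
      (∫ t, F t i j * ζ j t) - ∫ t, F t i j * ((M⁻¹ *ᵥ v) j • φ₀) t := by
    rw [← integral_sub (integrable_test_mul _ (hF i j).continuous _)
      (integrable_test_mul _ (hF i j).continuous _)]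
    refine integral_congr_ae (.of_forall fun t => ?_)
    simp only [Pi.sub_apply, sub_apply]
    ring
  simp only [hsub]
  rw [Finset.sum_sub_distrib, hMp, Matrix.mulVec_mulVec, Matrix.mul_nonsing_inv _ hM,
    Matrix.one_mulVec, sub_self]

end SDAE

namespace SDAE

/-! ### The adjoint operator and its canonical form -/

section Adjoint

variable {n : ℕ} {A B : Matrix (Fin n) (Fin n) ℝ}

/-- The adjoint `η ↦ -Aᵀ η' + Bᵀ η` of `x ↦ A x' + B x`, on vectors of test functions. -/
noncomputable def adjoint (A B : Matrix (Fin n) (Fin n) ℝ) (η : Fin n → Test) : Fin n → Test :=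
  act Bᵀ η - act Aᵀ (vderiv η)

theorem IsDAESolution.sum_adjoint {g x : Fin n → Distr} (h : IsDAESolution A B g x)
    (η : Fin n → Test) : ∑ j, x j (adjoint A B η j) = ∑ i, g i (η i) := by
  have h1 (i : Fin n) : g i (η i) =
      ∑ j, (B i j * x j (η i) - A i j * x j (∂_{(1 : ℝ)} (η i))) := by
    have := congrFun (h (η i)) i
    simp only [Pi.add_apply, Matrix.mulVec, dotProduct, pair, deriv_apply] at this
    rw [← this, ← Finset.sum_add_distrib]
    exact Finset.sum_congr rfl fun j _ => by ring
  simp only [h1]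
  rw [Finset.sum_comm]
  refine Finset.sum_congr rfl fun j _ => ?_
  simp only [adjoint, Pi.sub_apply, map_sub, act_apply, map_sum, map_smul, smul_eq_mul,
    Matrix.transpose_apply, vderiv_apply, Finset.sum_sub_distrib]

namespace KroneckerForm

variable (K : KroneckerForm A B)

/-- The numbering of the variables by differential and algebraic ones. -/
def varEquiv : Fin K.d ⊕ Fin K.q ≃ Fin n := finSumFinEquiv.trans (finCongr K.hdq)

theorem varEquiv_inl (i : Fin K.d) : K.varEquiv (.inl i) = Fin.cast K.hdq (Fin.castAdd K.q i) := rfl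

theorem inv_mul_Q : K.Q⁻¹ * K.Q = 1 :=
  Matrix.nonsing_inv_mul _ ((Matrix.isUnit_iff_isUnit_det _).mp K.hQ)

theorem mul_inv_Q : K.Q * K.Q⁻¹ = 1 :=
  Matrix.mul_nonsing_inv _ ((Matrix.isUnit_iff_isUnit_det _).mp K.hQ)

/-- The vector `Q⁻ᵀ (c φ₀, 0)` of test functions, which computes `c ⬝ ⟨u, φ₀⟩` for the differential
variables `u`. -/
noncomputable def initTest (φ₀ : Test) (c : Fin K.d → ℝ) : Fin n → Test :=
  act (K.Q⁻¹)ᵀ (Sum.elim (fun i => c i • φ₀) (0 : Fin K.q → Test) ∘ K.varEquiv.symm)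

theorem act_initTest (φ₀ : Test) (c : Fin K.d → ℝ) : act K.Qᵀ (K.initTest φ₀ c) =
    Sum.elim (fun i => c i • φ₀) (0 : Fin K.q → Test) ∘ K.varEquiv.symm := by
  rw [initTest, ← act_mul, ← Matrix.transpose_mul, K.inv_mul_Q, Matrix.transpose_one, act_one]

theorem act_Q_injective {η θ : Fin n → Test} (h : act K.Qᵀ η = act K.Qᵀ θ) : η = θ := by
  refine act_injective_of_left_inv (N := (K.Q⁻¹)ᵀ) ?_ h
  rw [← Matrix.transpose_mul, K.mul_inv_Q, Matrix.transpose_one]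

theorem sum_initTest (x : Fin n → Distr) (φ₀ : Test) (c : Fin K.d → ℝ) :
    ∑ j, x j (K.initTest φ₀ c j) =
      ∑ i, c i * (K.Q⁻¹ *ᵥ pair x φ₀) (Fin.cast K.hdq (Fin.castAdd K.q i)) := by
  simp only [initTest, act_apply, map_sum, map_smul, Matrix.transpose_apply, smul_eq_mul]
  rw [Finset.sum_comm, ← K.varEquiv.sum_comp, Fintype.sum_sum_type]
  simp only [Function.comp_apply, Equiv.symm_apply_apply, Sum.elim_inl, Sum.elim_inr,
    Pi.zero_apply, map_zero, mul_zero, Finset.sum_const_zero, add_zero, map_smul, smul_eq_mul]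
  simp only [varEquiv_inl, Matrix.mulVec, dotProduct, pair, Finset.mul_sum]
  exact Finset.sum_congr rfl fun i _ => Finset.sum_congr rfl fun j _ => by ring

/-- Substituting `Pᵀθ` and applying `Qᵀ` replaces the coefficients by the transposes of `P A Q` and
`P B Q`, so the adjoint decouples into its differential and algebraic blocks. -/
theorem act_adjoint (θ₁ : Fin K.d → Test) (θ₂ : Fin K.q → Test) :
    act K.Qᵀ (adjoint A B (act K.Pᵀ (Sum.elim θ₁ θ₂ ∘ K.varEquiv.symm))) =
      Sum.elim (act K.Jᵀ θ₁ - vderiv θ₁) (θ₂ - act K.Nᵀ (vderiv θ₂)) ∘ K.varEquiv.symm := by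
  have hd : vderiv (Sum.elim θ₁ θ₂ ∘ K.varEquiv.symm) =
      Sum.elim (vderiv θ₁) (vderiv θ₂) ∘ K.varEquiv.symm := by
    ext1 k
    simp only [vderiv_apply, Function.comp_apply]
    rcases K.varEquiv.symm k with i | i <;> rfl
  have hT (M : Matrix (Fin n) (Fin n) ℝ) : K.Qᵀ * (Mᵀ * K.Pᵀ) = (K.P * M * K.Q)ᵀ := by
    simp only [Matrix.transpose_mul]
  rw [adjoint, map_sub, vderiv_act, ← act_mul Bᵀ, ← act_mul Aᵀ, ← act_mul, ← act_mul, hT, hT,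
    K.hA, K.hB, hd, Matrix.transpose_reindex, Matrix.transpose_reindex,
    Matrix.fromBlocks_transpose, Matrix.fromBlocks_transpose]
  simp only [Matrix.transpose_one, Matrix.transpose_zero]
  change act (Matrix.reindex K.varEquiv K.varEquiv _) _ -
    act (Matrix.reindex K.varEquiv K.varEquiv _) _ = _
  rw [act_reindex, act_reindex, act_fromBlocks_diagonal, act_fromBlocks_diagonal, act_one, act_one]
  ext1 k
  simp only [Pi.sub_apply, Function.comp_apply]
  rcases K.varEquiv.symm k with i | i <;> rfl

/-- If no nonzero `initTest` is in the range of the adjoint, then every vector of test functions is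
in this range modulo some `initTest`. -/
theorem exists_adjoint_eq (φ₀ : Test)
    (h : ∀ (p : Fin K.d → ℝ) (η : Fin n → Test), adjoint A B η = K.initTest φ₀ p → p = 0)
    (ζ : Fin n → Test) :
    ∃ (c : Fin K.d → ℝ) (η : Fin n → Test), adjoint A B η = ζ - K.initTest φ₀ c := by
  -- A solution of the differential block for `p φ₀`, extended by zero in the algebraic block, puts
  -- an `initTest` in the range of the adjoint.
  obtain ⟨c, θ₁, h₁⟩ := exists_act_sub_vderiv_eq K.Jᵀ φ₀ (fun p θ hθ => by
    refine h p (act K.Pᵀ (Sum.elim θ 0 ∘ K.varEquiv.symm)) (K.act_Q_injective ?_)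
    rw [act_adjoint, act_initTest, hθ]
    simp) (fun i => act K.Qᵀ ζ (K.varEquiv (.inl i)))
  obtain ⟨θ₂, h₂⟩ := exists_sub_act_vderiv_eq (N := K.Nᵀ)
    (by obtain ⟨k, hk⟩ := K.hN; exact ⟨k, by rw [← Matrix.transpose_pow, hk, Matrix.transpose_zero]⟩)
    (fun i => act K.Qᵀ ζ (K.varEquiv (.inr i)))
  refine ⟨c, act K.Pᵀ (Sum.elim θ₁ θ₂ ∘ K.varEquiv.symm), K.act_Q_injective ?_⟩
  rw [act_adjoint, map_sub, act_initTest, h₁, h₂]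
  ext1 k
  obtain ⟨s, rfl⟩ := K.varEquiv.surjective k
  rcases s with i | i <;> simp

/-- A solution is determined by its right-hand side and its initial value. -/
theorem sum_solution_eq {g x : Fin n → Distr} (hx : IsDAESolution A B g x) {φ₀ : Test}
    {u₀ c : Fin K.d → ℝ} {ζ η : Fin n → Test}
    (h₀ : ∀ i, (K.Q⁻¹ *ᵥ pair x φ₀) (Fin.cast K.hdq (Fin.castAdd K.q i)) = u₀ i)
    (h : adjoint A B η = ζ - K.initTest φ₀ c) :
    ∑ j, x j (ζ j) = ∑ i, g i (η i) + c ⬝ᵥ u₀ := by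
  have h1 := hx.sum_adjoint η
  have h2 := K.sum_initTest x φ₀ c
  simp only [h, Pi.sub_apply, map_sub, Finset.sum_sub_distrib] at h1
  simp only [h₀] at h2
  rw [dotProduct, ← h2, ← h1]
  ring

end KroneckerForm

end Adjoint

/-! ### White noise -/

section Noise

theorem measurable_eval (φ : Test) : Measurable[borelDistr] fun T : Distr => T φ := by
  have h : @Continuous Distr ℝ weakStar inferInstance fun T => T φ := by
    have h1 : @Continuous Distr (Test → ℝ) weakStar inferInstance fun T φ => T φ :=
      continuous_induced_dom
    exact @Continuous.comp _ _ _ weakStar _ _ _ _ (continuous_apply φ) h1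
  exact @Continuous.measurable Distr ℝ weakStar borelDistr
    (@BorelSpace.opensMeasurable _ weakStar borelDistr (@BorelSpace.mk _ weakStar borelDistr rfl))
    _ _ _ _ h

variable {Ω : Type*} [MeasurableSpace Ω] {μ : Measure Ω}

theorem IsWhiteNoise.hasGaussianLaw {ξ : Ω → Distr} (h : IsWhiteNoise ξ μ) (φ : Test) :
    HasGaussianLaw (fun ω => ξ ω φ) μ := by
  obtain ⟨v, hv⟩ := h.gaussian φ
  exact ⟨by rw [hv]; infer_instance⟩

theorem IsWhiteNoise.variance_eq {ξ : Ω → Distr} (h : IsWhiteNoise ξ μ) (φ : Test) :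
    Var[fun ω => ξ ω φ; μ] = ∫ s, φ s ^ 2 := by
  obtain ⟨v, hv⟩ := h.gaussian φ
  have hm := (h.hasGaussianLaw φ).aemeasurable
  have h0 : ∫ ω, ξ ω φ ∂μ = 0 := by
    have := integral_map hm (f := fun y : ℝ => y) (by fun_prop)
    rw [← this, hv, integral_id_gaussianReal]
  rw [variance_of_integral_eq_zero hm h0]
  have := h.correlation φ φ
  simp only [← pow_two] at this
  refine this.trans ?_
  refine setIntegral_eq_integral_of_forall_compl_eq_zero fun s hs => ?_
  rw [image_eq_zero_of_notMem_tsupport fun h' => hs (φ.tsupport_subset h'), zero_pow two_ne_zero]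

theorem IsWhiteNoise.variance_eq_zero_iff {ξ : Ω → Distr} (h : IsWhiteNoise ξ μ) (φ : Test) :
    Var[fun ω => ξ ω φ; μ] = 0 ↔ φ = 0 := by
  rw [h.variance_eq]
  refine ⟨fun h0 => ?_, fun h0 => by simp [h0]⟩
  have hc : Continuous fun s => φ s ^ 2 := φ.continuous.pow 2
  have hi : Integrable fun s => φ s ^ 2 := by
    simpa only [pow_two] using integrable_test_mul φ φ.continuous φ
  rw [integral_eq_zero_iff_of_nonneg (fun s => sq_nonneg _) hi,
    hc.ae_eq_iff_eq volume continuous_zero] at h0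
  ext s
  exact pow_eq_zero_iff two_ne_zero |>.mp (congrFun h0 s)

variable {m : ℕ} {ξ : Ω → Fin m → Distr}

theorem IsWhiteNoiseVec.iIndepFun_apply (h : IsWhiteNoiseVec ξ μ) (ψ : Fin m → Test) :
    iIndepFun (fun l ω => ξ ω l (ψ l)) μ :=
  iIndepFun.comp (mβ := fun _ => borelDistr) h.indep (fun l T => T (ψ l))
    fun l => measurable_eval (ψ l)

theorem IsWhiteNoiseVec.hasGaussianLaw_sum (h : IsWhiteNoiseVec ξ μ) (ψ : Fin m → Test) :
    HasGaussianLaw (fun ω => ∑ l, ξ ω l (ψ l)) μ :=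
  (h.iIndepFun_apply ψ).hasGaussianLaw_fun_sum fun l => (h.whiteNoise l).hasGaussianLaw (ψ l)

/-- By independence the variances add, so each `‖ψ l‖²` in `L²` vanishes, and `ψ l` is continuous.
-/
theorem IsWhiteNoiseVec.eq_zero_of_variance_sum (h : IsWhiteNoiseVec ξ μ) {ψ : Fin m → Test}
    (h0 : Var[fun ω => ∑ l, ξ ω l (ψ l); μ] = 0) : ψ = 0 := by
  have hv : Var[fun ω => ∑ l, ξ ω l (ψ l); μ] = ∑ l, Var[fun ω => ξ ω l (ψ l); μ] := by
    have := IndepFun.variance_sum (X := fun l ω => ξ ω l (ψ l)) (s := Finset.univ) (μ := μ)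
      (fun l _ => ((h.whiteNoise l).hasGaussianLaw (ψ l)).memLp_two)
      fun i _ j _ hij => (h.iIndepFun_apply ψ).indepFun hij
    rw [← this]
    congr 1
    ext ω
    simp
  rw [hv, Finset.sum_eq_zero_iff_of_nonneg fun l _ => variance_nonneg _ _] at h0
  ext1 l
  exact ((h.whiteNoise l).variance_eq_zero_iff (ψ l)).mp (h0 l (Finset.mem_univ l))

end Noise

/-- Full row rank makes `Λᵀ` injective; this is applied at each point `t`. -/
theorem act_transpose_eq_zero_of_rank {n m : ℕ} {Λ : Matrix (Fin n) (Fin m) ℝ} (hΛ : Λ.rank = n)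
    {η : Fin n → Test} (h : act Λᵀ η = 0) : η = 0 := by
  have hli : LinearIndependent ℝ Λ.row := by
    rw [linearIndependent_iff_card_eq_finrank_span, Fintype.card_fin, Set.finrank,
      ← Matrix.rank_eq_finrank_span_row, hΛ]
  have hinj := Matrix.vecMul_injective_iff.mpr hli
  have ht (t : ℝ) : (fun j => η j t) = 0 := by
    refine hinj ?_
    ext l
    have := congrArg (fun φ : Test => φ t) (congrFun h l)
    simp only [act_apply_apply, Matrix.mulVec_transpose] at this
    simpa using this
  ext j t
  exact congrFun (ht t) j

end SDAE

/-! ### Uniqueness and law of the solution -/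

namespace SDAE

theorem deriv_iterate_apply_zero (T : Distr) (k : ℕ) : (deriv^[k] T) (0 : Test) = 0 := map_zero _

section Solution

variable {Ω : Type*} [MeasurableSpace Ω] {μ : Measure Ω} {n m : ℕ}
  {A B : Matrix (Fin n) (Fin n) ℝ} {Λ : Matrix (Fin n) (Fin m) ℝ} {f : Fin n → Distr}
  {ξ : Ω → Fin m → Distr} {K : KroneckerForm A B} {φ₀ : Test} {u₀ : Fin K.d → ℝ}
  {x : Ω → Fin n → Distr}

/-- A solution tested against `ζ` is an affine function of the noise tested against `Λᵀ η`. -/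
theorem IsSDAESolution.ae_sum_eq (hx : IsSDAESolution A B f Λ ξ μ x)
    (hx₀ : HasInitialValue K φ₀ u₀ μ x) {c : Fin K.d → ℝ} {ζ η : Fin n → Test}
    (h : adjoint A B η = ζ - K.initTest φ₀ c) :
    ∀ᵐ ω ∂μ, ∑ j, x ω j (ζ j) =
      (∑ i, f i (η i) + c ⬝ᵥ u₀) + ∑ l, ξ ω l (act Λᵀ η l) := by
  filter_upwards [hx.ae_solution, hx₀] with ω h1 h2
  rw [K.sum_solution_eq h1 h2 h]
  have (i : Fin n) : (f i + ∑ l, Λ i l • ξ ω l) (η i) =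
      f i (η i) + ∑ l, Λ i l * ξ ω l (η i) := by
    simp
  simp only [this, Finset.sum_add_distrib, act_apply, map_sum, map_smul, smul_eq_mul,
    Matrix.transpose_apply]
  rw [Finset.sum_comm]
  ring

theorem KroneckerForm.eq_zero_of_initTest_eq_zero (hφ₀ : φ₀ ≠ 0) {p : Fin K.d → ℝ}
    (h : K.initTest φ₀ p = 0) : p = 0 := by
  have h1 := K.act_initTest φ₀ p
  rw [h, map_zero] at h1
  ext i
  have h2 := congrFun h1 (K.varEquiv (.inl i))
  simp only [Function.comp_apply, Equiv.symm_apply_apply, Sum.elim_inl, Pi.zero_apply] at h2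
  exact (smul_eq_zero.mp h2.symm).resolve_right hφ₀

/-- The existence of a solution with a deterministic initial value makes the adjoint equation
solvable modulo `φ₀`: an obstruction would be a nondegenerate Gaussian variable that is almost
surely constant. -/
theorem IsSDAESolution.exists_adjoint_eq [IsProbabilityMeasure μ] (hΛ : Λ.rank = n)
    (hξ : IsWhiteNoiseVec ξ μ) (hφ₀ : φ₀ ≠ 0) (hx : IsSDAESolution A B f Λ ξ μ x)
    (hx₀ : HasInitialValue K φ₀ u₀ μ x) (ζ : Fin n → Test) :
    ∃ (c : Fin K.d → ℝ) (η : Fin n → Test), adjoint A B η = ζ - K.initTest φ₀ c := by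
  refine K.exists_adjoint_eq φ₀ (fun p η hη => ?_) ζ
  have h1 := hx.ae_sum_eq hx₀ (c := 0) (ζ := K.initTest φ₀ p) (η := η) (by
    have : K.initTest φ₀ 0 = 0 := K.act_Q_injective (by
      rw [K.act_initTest, map_zero]
      ext1 k
      simp only [Function.comp_apply]
      rcases K.varEquiv.symm k with i | i <;> simp)
    rw [this, sub_zero, hη])
  -- The value of `x` at `initTest φ₀ p` is computed twice: from the equation through `η`, and from
  -- the initial condition as `p ⬝ᵥ u₀`.
  have h2 : (fun ω => ∑ l, ξ ω l (act Λᵀ η l)) =ᵐ[μ]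
      fun _ => p ⬝ᵥ u₀ - (∑ i, f i (η i) + (0 : Fin K.d → ℝ) ⬝ᵥ u₀) := by
    filter_upwards [h1, hx₀] with ω h3 h4
    rw [K.sum_initTest] at h3
    simp only [h4] at h3
    rw [dotProduct, h3]
    ring
  have h5 := hξ.eq_zero_of_variance_sum (ψ := act Λᵀ η) (by
    rw [variance_congr h2]
    simp [variance_eq_integral aemeasurable_const])
  have h6 := act_transpose_eq_zero_of_rank hΛ h5
  refine K.eq_zero_of_initTest_eq_zero hφ₀ ?_
  rw [← hη, h6, adjoint, map_zero, map_zero, map_zero, sub_zero]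

theorem eq_of_forall_sum_eq {S T : Fin n → Distr}
    (h : ∀ ζ : Fin n → Test, ∑ j, S j (ζ j) = ∑ j, T j (ζ j)) : S = T := by
  ext i φ
  have (R : Fin n → Distr) : ∑ j, R j ((Pi.single i φ : Fin n → Test) j) = R i φ := by
    rw [Finset.sum_eq_single i (fun j _ hj => by simp [hj]) (by simp), Pi.single_eq_same]
  rw [← this S, ← this T, h]

theorem IsSDAESolution.ae_eq [IsProbabilityMeasure μ] (hΛ : Λ.rank = n)
    (hξ : IsWhiteNoiseVec ξ μ) (hφ₀ : φ₀ ≠ 0) (hx : IsSDAESolution A B f Λ ξ μ x)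
    (hx₀ : HasInitialValue K φ₀ u₀ μ x) {y : Ω → Fin n → Distr}
    (hy : IsSDAESolution A B f Λ ξ μ y) (hy₀ : HasInitialValue K φ₀ u₀ μ y) :
    ∀ᵐ ω ∂μ, y ω = x ω := by
  -- The exceptional null set is fixed before `ζ`, so the uncountably many test vectors cause no
  -- difficulty.
  filter_upwards [hx.ae_solution, hx₀, hy.ae_solution, hy₀] with ω h1 h2 h3 h4
  refine eq_of_forall_sum_eq fun ζ => ?_
  obtain ⟨c, η, h⟩ := hx.exists_adjoint_eq hΛ hξ hφ₀ hx₀ ζ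
  rw [K.sum_solution_eq h1 h2 h, K.sum_solution_eq h3 h4 h]

/-- At `φ = 0` the covariance matrix has a zero row; positivity of `k` and `m` ensures that it has a
row at all. -/
theorem ne_zero_of_mem_nonsingularTests {k : ℕ} (hk : 0 < k) (hm : 0 < m) {φ : Test}
    (hφ : φ ∈ nonsingularTests ξ μ k) : φ ≠ 0 := by
  rintro rfl
  refine hφ (Matrix.det_eq_zero_of_row_eq_zero (⟨0, hk⟩, ⟨0, hm⟩) fun b => ?_)
  simp only [covMatrix, Matrix.of_apply, deriv_iterate_apply_zero]
  exact covariance_zero_left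

/-- A nonzero combination of the components of `φ` is not an `initTest`. -/
theorem eq_zero_of_smul_eq_initTest (hΛ : Λ.rank = n) {φ : Test}
    (hφ : φ ∈ nonsingularTests ξ μ K.index) (h : K.d = 0 ∨ ∀ c : ℝ, φ ≠ c • φ₀)
    {a : Fin n → ℝ} {c : Fin K.d → ℝ} (hac : (fun i => a i • φ) = K.initTest φ₀ c) : a = 0 := by
  have h1 := congrArg (act K.Qᵀ) hac
  rw [K.act_initTest] at h1
  have h2 (k : Fin n) : act K.Qᵀ (fun i => a i • φ) k = (K.Qᵀ *ᵥ a) k • φ := by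
    simp only [act_apply, smul_smul, ← Finset.sum_smul]
    rfl
  have h3 : K.Qᵀ *ᵥ a = 0 := by
    ext1 k
    obtain ⟨s, rfl⟩ := K.varEquiv.surjective k
    have h4 := congrFun h1 (K.varEquiv s)
    rw [h2, Function.comp_apply, Equiv.symm_apply_apply] at h4
    by_contra hne
    rw [Pi.zero_apply] at hne
    rcases s with i | i
    -- A differential coordinate with nonzero coefficient would make `φ` a multiple of `φ₀`.
    · rcases h with h | h
      · exact (Fin.cast h i).elim0
      · refine h (((K.Qᵀ *ᵥ a) (K.varEquiv (.inl i)))⁻¹ * c i) ?_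
        rw [mul_smul, ← inv_smul_smul₀ hne φ, h4]
        rfl
    -- In an algebraic coordinate the right-hand side is zero, so `φ ≠ 0` is needed. Such a
    -- coordinate exists only if `q > 0`, which makes the index positive and gives `m ≥ n > 0`.
    · have hq : 0 < K.q := i.pos
      have hn : 0 < n := by have := K.hdq; omega
      have hm : 0 < m := by
        have := Λ.rank_le_width
        omega
      have : Nonempty (Fin K.q) := ⟨i⟩
      have hr : 0 < K.index := pos_nilpotencyClass_iff.mpr K.hN
      exact (smul_eq_zero.mp h4).elim hne (ne_zero_of_mem_nonsingularTests hr hm hφ)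
  have hQ : K.Qᵀ⁻¹ * K.Qᵀ = 1 := Matrix.nonsing_inv_mul _ (by
    rw [Matrix.det_transpose]
    exact (Matrix.isUnit_iff_isUnit_det _).mp K.hQ)
  rw [← Matrix.one_mulVec a, ← hQ, ← Matrix.mulVec_mulVec, h3, Matrix.mulVec_zero]

theorem IsSDAESolution.absolutelyContinuous_map [IsProbabilityMeasure μ] (hΛ : Λ.rank = n)
    (hξ : IsWhiteNoiseVec ξ μ) (hφ₀ : φ₀ ≠ 0) (hx : IsSDAESolution A B f Λ ξ μ x)
    (hx₀ : HasInitialValue K φ₀ u₀ μ x) {φ : Test} (hφ : φ ∈ nonsingularTests ξ μ K.index)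
    (h : K.d = 0 ∨ ∀ c : ℝ, φ ≠ c • φ₀) :
    (μ.map fun ω => pair (x ω) φ) ≪ (volume : Measure (Fin n → ℝ)) := by
  have repr (a : Fin n → ℝ) : ∃ (c : Fin K.d → ℝ) (η : Fin n → Test) (C : ℝ),
      adjoint A B η = (fun i => a i • φ) - K.initTest φ₀ c ∧
      (fun ω => a ⬝ᵥ pair (x ω) φ) =ᵐ[μ] fun ω => C + ∑ l, ξ ω l (act Λᵀ η l) := by
    obtain ⟨c, η, hη⟩ := hx.exists_adjoint_eq hΛ hξ hφ₀ hx₀ fun i => a i • φ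
    refine ⟨c, η, ∑ i, f i (η i) + c ⬝ᵥ u₀, hη, ?_⟩
    filter_upwards [hx.ae_sum_eq hx₀ hη] with ω hω
    rw [← hω]
    simp [dotProduct, pair]
  have hmeas : Measurable fun ω => pair (x ω) φ :=
    measurable_pi_lambda _ fun i => (measurable_eval φ).comp (hx.isRandomDistribution i)
  refine HasGaussianLaw.absolutelyContinuous_map
    (hasGaussianLaw_of_forall_dotProduct hmeas.aemeasurable fun a => ?_) fun a ha hvar => ha ?_
  · obtain ⟨c, η, C, -, hC⟩ := repr a
    refine HasGaussianLaw.congr ?_ hC.symm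
    have hW := hξ.hasGaussianLaw_sum (act Λᵀ η)
    refine ⟨?_⟩
    have := hW.isGaussian_map
    have hmap : μ.map (fun ω => C + ∑ l, ξ ω l (act Λᵀ η l)) =
        (μ.map fun ω => ∑ l, ξ ω l (act Λᵀ η l)).map (C + ·) :=
      (AEMeasurable.map_map_of_aemeasurable (by fun_prop) hW.aemeasurable).symm
    rw [hmap]
    infer_instance
  · obtain ⟨c, η, C, hη, hC⟩ := repr a
    have hW := (hξ.hasGaussianLaw_sum (act Λᵀ η)).aemeasurable
    rw [variance_congr hC, variance_const_add hW.aestronglyMeasurable] at hvar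
    have h0 := act_transpose_eq_zero_of_rank hΛ (hξ.eq_zero_of_variance_sum hvar)
    -- Zero variance gave `η = 0`, so `a φ` equals `initTest φ₀ c`.
    refine eq_zero_of_smul_eq_initTest hΛ hφ h (c := c) (sub_eq_zero.mp ?_)
    rw [← hη, h0, adjoint, map_zero, map_zero, map_zero, sub_zero]

end Solution

end SDAE

theorem theorem4p4 {n m : ℕ} (A B : Matrix (Fin n) (Fin n) ℝ) (Λ : Matrix (Fin n) (Fin m) ℝ)
    (f : Fin n → SDAE.Distr) (hAB : SDAE.IsRegularPencil A B) (hΛ : Λ.rank = n)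
    {Ω : Type*} [MeasurableSpace Ω] (μ : Measure Ω) [IsProbabilityMeasure μ]
    (ξ : Ω → Fin m → SDAE.Distr) (hξ : SDAE.IsWhiteNoiseVec ξ μ)
    (K : SDAE.KroneckerForm A B) (φ₀ : SDAE.Test) (hφ₀ : φ₀ ≠ 0) (u₀ : Fin K.d → ℝ)
    (x : Ω → Fin n → SDAE.Distr) (hx : SDAE.IsSDAESolution A B f Λ ξ μ x)
    (hx₀ : SDAE.HasInitialValue K φ₀ u₀ μ x) :
    (∀ y : Ω → Fin n → SDAE.Distr, SDAE.IsSDAESolution A B f Λ ξ μ y →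
      SDAE.HasInitialValue K φ₀ u₀ μ y → ∀ᵐ ω ∂μ, y ω = x ω) ∧
    ∀ φ ∈ SDAE.nonsingularTests ξ μ K.index, (K.d = 0 ∨ ∀ c : ℝ, φ ≠ c • φ₀) →
      (μ.map fun ω => SDAE.pair (x ω) φ) ≪ (volume : Measure (Fin n → ℝ)) := by
  exact ⟨fun y hy hy₀ => hx.ae_eq hΛ hξ hφ₀ hx₀ hy hy₀,
    fun φ hφ h => hx.absolutelyContinuous_map hΛ hξ hφ₀ hx₀ hφ h⟩
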